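/- Let $\mathbb{H}=\{z\in\mathbb{C}:\operatorname{Im} z>0\}$. Let $H^\infty(\mathbb{H}^2)$ be the space of bounded analytic functions on $\mathbb{H}^2=\mathbb{H}\times\mathbb{H}$, and let $H^2(\mathbb{H}^2)$ be the Hardy space of all analytic functions $f:\mathbb{H}^2\to\mathbb{C}$ with $$\|f\|=\sup_{y\in(0,\infty)^2}\Big(\int_{\mathbb{R}^2}|f(x+iy)|^2\,dx\Big)^{1/2}<\infty .$$ Let $p_1,p_2>0$ and $\delta>0$ be real numbers, let $\psi_1,\psi_2\in H^\infty(\mathbb{H}^2)$ satisfy $\operatorname{Im}\psi_j(z_1,z_2)>\delta$ for all $(z_1,z_2)\in\mathbb{H}^2$, $j=1,2$, and let $\varphi:\mathbb{H}^2\to\mathbb{H}^2$ be the analytic self-map $$\varphi(z_1,z_2)=\big(p_1z_1+\psi_1(z_1,z_2),\;p_2z_2+\psi_2(z_1,z_2)\big).$$ Then the composition operator $C_\varphi f=f\circ\varphi$ maps $H^2(\mathbb{H}^2)$ into itself and is a bounded linear operator on $H^2(\mathbb{H}^2)$. -/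

import Mathlib

open scoped UpperHalfPlane ENNReal

noncomputable section

namespace BiHalfPlane

/-- The product of two open upper half-planes, as an open subset of `ℂ × ℂ`. The type of its
points is `ℍ × ℍ`. -/
def domain : Set (ℂ × ℂ) := {w | 0 < w.1.im ∧ 0 < w.2.im}

/-- `f : ℍ × ℍ → ℂ` is analytic: it is complex (Fréchet) differentiable as a function on the open
subset `domain` of `ℂ × ℂ`. The map `UpperHalfPlane.ofComplex` is a left inverse of the
inclusion of `ℍ` in `ℂ`; its values outside the half-plane play no role here. -/
def IsAnalytic (f : ℍ × ℍ → ℂ) : Prop :=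
  DifferentiableOn ℂ
    (fun w : ℂ × ℂ => f (UpperHalfPlane.ofComplex w.1, UpperHalfPlane.ofComplex w.2)) domain

/-- `ψ` belongs to `H^∞(ℍ²)`: it is analytic and bounded. -/
def MemHInfty (ψ : ℍ × ℍ → ℂ) : Prop :=
  IsAnalytic ψ ∧ ∃ M : ℝ, ∀ z, ‖ψ z‖ ≤ M

/-- The point `x + i y` of `ℍ × ℍ`, for `x ∈ ℝ²` and `y ∈ (0, ∞)²`. -/
def tubePoint (x : ℝ × ℝ) (y : {t : ℝ // 0 < t} × {t : ℝ // 0 < t}) : ℍ × ℍ :=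
  (⟨⟨x.1, y.1⟩, y.1.2⟩, ⟨⟨x.2, y.2⟩, y.2.2⟩)

/-- The Hardy norm
`sup_{y ∈ (0, ∞)²} (∫_{ℝ²} |f (x + i y)|² dx)^{1/2}`, with values in `[0, ∞]`. -/
def hardyNorm (f : ℍ × ℍ → ℂ) : ℝ≥0∞ :=
  ⨆ y : {t : ℝ // 0 < t} × {t : ℝ // 0 < t},
    MeasureTheory.eLpNorm (fun x : ℝ × ℝ => f (tubePoint x y)) 2 MeasureTheory.volume

theorem IsAnalytic.continuous_slice {f : ℍ × ℍ → ℂ} (hf : IsAnalytic f)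
    (y : {t : ℝ // 0 < t} × {t : ℝ // 0 < t}) :
    Continuous (fun x : ℝ × ℝ => f (tubePoint x y)) := by
  have h1 : Continuous (fun x : ℝ × ℝ =>
      (((x.1 : ℂ) + (y.1 : ℝ) * Complex.I, (x.2 : ℂ) + (y.2 : ℝ) * Complex.I) : ℂ × ℂ)) := by
    fun_prop
  have h2 : ∀ x : ℝ × ℝ,
      (((x.1 : ℂ) + (y.1 : ℝ) * Complex.I, (x.2 : ℂ) + (y.2 : ℝ) * Complex.I) : ℂ × ℂ)
        ∈ domain := by
    intro x
    refine ⟨?_, ?_⟩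
    · simpa using y.1.2
    · simpa using y.2.2
  have h3 := hf.continuousOn.comp_continuous h1 h2
  refine h3.congr fun x => ?_
  have e : ∀ (a : ℝ) (b : {t : ℝ // 0 < t}),
      UpperHalfPlane.ofComplex ((a : ℂ) + (b : ℝ) * Complex.I) = ⟨⟨a, b⟩, b.2⟩ := by
    intro a b
    have hab : ((a : ℂ) + (b : ℝ) * Complex.I) = (⟨⟨a, b⟩, b.2⟩ : ℍ) := by
      apply Complex.ext <;> simp
    rw [hab, UpperHalfPlane.ofComplex_apply]
  change f (UpperHalfPlane.ofComplex _, UpperHalfPlane.ofComplex _) = f (tubePoint x y)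
  rw [e, e]
  rfl

theorem hardyNorm_add_le {f g : ℍ × ℍ → ℂ} (hf : IsAnalytic f) (hg : IsAnalytic g) :
    hardyNorm (f + g) ≤ hardyNorm f + hardyNorm g := by
  refine iSup_le fun y => ?_
  refine (MeasureTheory.eLpNorm_add_le (hf.continuous_slice y).aestronglyMeasurable
    (hg.continuous_slice y).aestronglyMeasurable (by norm_num)).trans ?_
  exact add_le_add (le_iSup (fun y => MeasureTheory.eLpNorm
    (fun x : ℝ × ℝ => f (tubePoint x y)) 2 MeasureTheory.volume) y)
    (le_iSup (fun y => MeasureTheory.eLpNorm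
    (fun x : ℝ × ℝ => g (tubePoint x y)) 2 MeasureTheory.volume) y)

theorem hardyNorm_smul (c : ℂ) (f : ℍ × ℍ → ℂ) :
    hardyNorm (c • f) = ‖c‖ₑ * hardyNorm f := by
  unfold hardyNorm
  rw [ENNReal.mul_iSup]
  refine iSup_congr fun y => ?_
  exact MeasureTheory.eLpNorm_const_smul c (fun x : ℝ × ℝ => f (tubePoint x y)) 2
    MeasureTheory.volume

theorem hardyNorm_zero : hardyNorm 0 = 0 := by
  simp [hardyNorm]

theorem eq_zero_of_hardyNorm_eq_zero {f : ℍ × ℍ → ℂ} (hf : IsAnalytic f)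
    (h : hardyNorm f = 0) : f = 0 := by
  funext z
  have hy := (ENNReal.iSup_eq_zero.1 h) (⟨z.1.im, z.1.im_pos⟩, ⟨z.2.im, z.2.im_pos⟩)
  have hc := hf.continuous_slice (⟨z.1.im, z.1.im_pos⟩, ⟨z.2.im, z.2.im_pos⟩)
  rw [MeasureTheory.eLpNorm_eq_zero_iff hc.aestronglyMeasurable (by norm_num)] at hy
  have h0 := (hc.ae_eq_iff_eq MeasureTheory.volume continuous_zero).1 hy
  exact congrFun h0 (z.1.re, z.2.re)

/-- The functions that form `H²(ℍ²)`: analytic, with finite Hardy norm. -/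
def hardySubmodule : Submodule ℂ (ℍ × ℍ → ℂ) where
  carrier := {f | IsAnalytic f ∧ hardyNorm f < ∞}
  add_mem' := fun {f g} hf hg =>
    ⟨DifferentiableOn.add hf.1 hg.1,
      (hardyNorm_add_le hf.1 hg.1).trans_lt (ENNReal.add_lt_top.2 ⟨hf.2, hg.2⟩)⟩
  zero_mem' := ⟨differentiableOn_const 0, by rw [hardyNorm_zero]; exact ENNReal.zero_lt_top⟩
  smul_mem' := fun c f hf =>
    ⟨DifferentiableOn.const_smul hf.1 c, by
      rw [hardyNorm_smul]; exact ENNReal.mul_lt_top enorm_lt_top hf.2⟩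

/-- The Hardy space `H²(ℍ²)`. It is a type of its own, so that the only topology it carries is
that of the Hardy norm. -/
def HardySpace : Type := hardySubmodule

namespace HardySpace

instance : AddCommGroup HardySpace := inferInstanceAs (AddCommGroup hardySubmodule)

instance : Module ℂ HardySpace := inferInstanceAs (Module ℂ hardySubmodule)

instance : CoeFun HardySpace (fun _ => ℍ × ℍ → ℂ) where
  coe f := f.1

instance : Norm HardySpace where
  norm f := (hardyNorm f).toReal

theorem core : NormedSpace.Core ℂ HardySpace where
  norm_nonneg _ := ENNReal.toReal_nonneg
  norm_smul c f := by
    change (hardyNorm (c • f.1)).toReal = ‖c‖ * (hardyNorm f.1).toReal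
    rw [hardyNorm_smul, ENNReal.toReal_mul, toReal_enorm]
  norm_triangle f g := by
    change (hardyNorm (f.1 + g.1)).toReal ≤ (hardyNorm f.1).toReal + (hardyNorm g.1).toReal
    rw [← ENNReal.toReal_add f.2.2.ne g.2.2.ne]
    exact ENNReal.toReal_mono (ENNReal.add_lt_top.2 ⟨f.2.2, g.2.2⟩).ne
      (hardyNorm_add_le f.2.1 g.2.1)
  norm_eq_zero_iff f := by
    constructor
    · intro h
      have h' : hardyNorm f.1 = 0 :=
        ((ENNReal.toReal_eq_zero_iff _).1 h).resolve_right f.2.2.ne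
      exact Subtype.ext (eq_zero_of_hardyNorm_eq_zero f.2.1 h')
    · rintro rfl
      change (hardyNorm 0).toReal = 0
      rw [hardyNorm_zero, ENNReal.toReal_zero]

instance : NormedAddCommGroup HardySpace := NormedAddCommGroup.ofCore core

instance : NormedSpace ℂ HardySpace := NormedSpace.ofCore core

end HardySpace

end BiHalfPlane

end

/-! The modulus `|f|²` satisfies a sub-mean value inequality, so `|f(φ(z))|²` is at most the average
of `|f|²` over the bidisc of radius `δ` about `φ(z)`; this bidisc stays in `ℍ²` because `Im ψ_j >
δ`. Since each `ψ_j` is bounded, the bidisc lies within a fixed distance `R` of `(p₁z₁, p₂z₂)` in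
each coordinate, and its imaginary parts lie in `[p_j y_j, p_j y_j + R]`.

Integrate over `x` with `y` fixed and exchange the integrals. A given `ζ` is reached only from `x`
in a rectangle with sides `2R/p_j`, and `|f|²` integrates over the strip of admissible `ζ` to at
most `R²‖f‖²`. Neither factor depends on `y`. The carrying lemmas are `enorm_mul_volume_bidisc_le`,
`setLIntegral_strip_sqDensity_le` and `lintegral_enorm_sq_comp_slice_mul_le`. -/

noncomputable section

namespace BiHalfPlane

open MeasureTheory Metric Set

/-! ### Sub-mean value inequalities on discs and bidiscs. -/

/-- The mean value property of a holomorphic function over a circle, as an inequality between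
lower Lebesgue integrals. -/
theorem enorm_mul_two_pi_le_lintegral_circleMap {h : ℂ → ℂ} {c : ℂ} {r : ℝ}
    (hh : DiffContOnCl ℂ h (ball c |r|)) :
    ‖h c‖ₑ * ENNReal.ofReal (2 * Real.pi) ≤
      ∫⁻ θ in Ioo (-Real.pi) Real.pi, ‖h (circleMap c r θ)‖ₑ := by
  have hpi : (0 : ℝ) < 2 * Real.pi := by positivity
  have h1 : (2 * Real.pi) • h c = ∫ θ in (-Real.pi)..Real.pi, h (circleMap c r θ) := by
    rw [← hh.circleAverage, Real.circleAverage_eq_integral_add (-Real.pi), smul_inv_smul₀ hpi.ne',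
      intervalIntegral.integral_comp_add_right (fun θ => h (circleMap c r θ))]
    congr 1 <;> ring
  have h2 : ‖h c‖ₑ * ENNReal.ofReal (2 * Real.pi) = ‖(2 * Real.pi) • h c‖ₑ := by
    rw [enorm_smul, Real.enorm_of_nonneg hpi.le, mul_comm]
  rw [h2, h1, intervalIntegral.integral_of_le (by linarith [Real.pi_pos]),
    restrict_Ioo_eq_restrict_Ioc]
  exact enorm_integral_le_lintegral_enorm _

/-- Integration over a disc in polar coordinates. -/
theorem setLIntegral_ball_eq_polar {g : ℂ → ℝ≥0∞} (hg : Measurable g) (c : ℂ) (R : ℝ) :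
    ∫⁻ ζ in ball c R, g ζ = ∫⁻ r in Ioo 0 R, ENNReal.ofReal r *
      ∫⁻ θ in Ioo (-Real.pi) Real.pi, g (circleMap c r θ) := by
  have hm : Measurable ((ball c R).indicator g) := hg.indicator measurableSet_ball
  have e : ∀ p : ℝ × ℝ, c + Complex.polarCoord.symm p = circleMap c p.1 p.2 := by
    intro p
    simp [Complex.polarCoord_symm_apply, circleMap, Complex.exp_mul_I]
  have hcm : Measurable fun p : ℝ × ℝ => circleMap c p.1 p.2 := by
    unfold circleMap
    fun_prop
  rw [← lintegral_indicator measurableSet_ball,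
    ← lintegral_add_left_eq_self ((ball c R).indicator g) c,
    ← Complex.lintegral_comp_polarCoord_symm, polarCoord_target]
  simp only [e, smul_eq_mul]
  rw [Measure.volume_eq_prod, setLIntegral_prod _ (by fun_prop)]
  have key : ∀ r ∈ Ioi (0 : ℝ), (∫⁻ θ in Ioo (-Real.pi) Real.pi,
      ENNReal.ofReal r * (ball c R).indicator g (circleMap c r θ)) =
      (Iio R).indicator (fun r => ENNReal.ofReal r *
        ∫⁻ θ in Ioo (-Real.pi) Real.pi, g (circleMap c r θ)) r := by
    intro r hr
    have hmem : ∀ θ, circleMap c r θ ∈ ball c R ↔ r < R := by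
      intro θ
      simp [mem_ball, dist_eq_norm, circleMap, abs_of_pos (mem_Ioi.1 hr)]
    by_cases hrR : r < R
    · rw [indicator_of_mem (mem_Iio.2 hrR), ← lintegral_const_mul' _ _ ENNReal.ofReal_ne_top]
      simp [hmem, hrR]
    · rw [indicator_of_notMem (by simpa using hrR)]
      simp [hmem, hrR]
  rw [setLIntegral_congr_fun measurableSet_Ioi key, setLIntegral_indicator measurableSet_Iio,
    inter_comm, Ioi_inter_Iio]

/-- The sub-mean value property of the modulus of a holomorphic function over a disc. -/
theorem enorm_mul_volume_ball_le {h : ℂ → ℂ} {F : ℂ → ℝ≥0∞} (hF : Measurable F) {c : ℂ} {R : ℝ}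
    (hh : DifferentiableOn ℂ h (ball c R)) (hFh : ∀ ζ ∈ ball c R, F ζ = ‖h ζ‖ₑ) :
    ‖h c‖ₑ * volume (ball c R) ≤ ∫⁻ ζ in ball c R, F ζ := by
  -- Both sides are put in polar coordinates, so circles are compared radius by radius and the area
  -- of the disc is never computed.
  rw [← setLIntegral_const, setLIntegral_ball_eq_polar measurable_const,
    setLIntegral_ball_eq_polar hF]
  refine setLIntegral_mono' measurableSet_Ioo fun r hr => ?_
  gcongr 1
  have hsub : closedBall c |r| ⊆ ball c R := by
    rw [abs_of_pos hr.1]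
    exact closedBall_subset_ball hr.2
  have hd : DiffContOnCl ℂ h (ball c |r|) :=
    (hh.mono (closure_ball_subset_closedBall.trans hsub)).diffContOnCl
  have hFc : ∀ θ, F (circleMap c r θ) = ‖h (circleMap c r θ)‖ₑ := fun θ =>
    hFh _ (hsub (sphere_subset_closedBall (circleMap_mem_sphere' c r θ)))
  simp only [hFc]
  refine le_trans (le_of_eq ?_) (enorm_mul_two_pi_le_lintegral_circleMap hd)
  rw [setLIntegral_const, Real.volume_Ioo]
  congr 2
  ring

/-- The sub-mean value property of the modulus of a holomorphic function over a bidisc. -/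
theorem enorm_mul_volume_bidisc_le {h : ℂ × ℂ → ℂ} {F : ℂ × ℂ → ℝ≥0∞} (hF : Measurable F)
    {c : ℂ × ℂ} {R : ℝ} (hR : 0 < R) (hh : DifferentiableOn ℂ h (ball c.1 R ×ˢ ball c.2 R))
    (hFh : ∀ ζ ∈ ball c.1 R ×ˢ ball c.2 R, F ζ = ‖h ζ‖ₑ) :
    ‖h c‖ₑ * (volume (ball c.1 R) * volume (ball c.2 R)) ≤
      ∫⁻ ζ in ball c.1 R ×ˢ ball c.2 R, F ζ := by
  have hc2 : c.2 ∈ ball c.2 R := mem_ball_self hR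
  rw [Measure.volume_eq_prod, setLIntegral_prod _ hF.aemeasurable, ← mul_assoc]
  -- One variable at a time: first with the second variable frozen at its centre, then in the second
  -- variable for each `a`.
  calc ‖h c‖ₑ * volume (ball c.1 R) * volume (ball c.2 R)
      ≤ (∫⁻ a in ball c.1 R, F (a, c.2)) * volume (ball c.2 R) := by
        gcongr 1
        refine enorm_mul_volume_ball_le (h := fun a => h (a, c.2)) (by fun_prop) ?_
          fun a ha => hFh _ ⟨ha, hc2⟩
        exact hh.comp (by fun_prop) fun a ha => ⟨ha, hc2⟩
    _ = ∫⁻ a in ball c.1 R, F (a, c.2) * volume (ball c.2 R) :=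
        (lintegral_mul_const _ (by fun_prop)).symm
    _ ≤ ∫⁻ a in ball c.1 R, ∫⁻ b in ball c.2 R, F (a, b) := by
        refine setLIntegral_mono' measurableSet_ball fun a ha => ?_
        rw [hFh (a, c.2) ⟨ha, hc2⟩]
        refine enorm_mul_volume_ball_le (h := fun b => h (a, b)) (by fun_prop) ?_
          fun b hb => hFh _ ⟨ha, hb⟩
        exact hh.comp (by fun_prop) fun b hb => ⟨ha, hb⟩

/-! ### Slicing `ℂ × ℂ` by imaginary parts. -/

/-- Integration over `ℂ × ℂ` as an iterated integral over imaginary and real parts. -/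
theorem lintegral_complex_prod {G : ℂ × ℂ → ℝ≥0∞} (hG : Measurable G) :
    ∫⁻ ζ, G ζ = ∫⁻ v : ℝ × ℝ, ∫⁻ x : ℝ × ℝ, G (⟨x.1, v.1⟩, ⟨x.2, v.2⟩) := by
  have hmk : Measurable fun p : ℝ × ℝ => (⟨p.1, p.2⟩ : ℂ) :=
    Complex.measurableEquivRealProd.symm.measurable
  have hone : ∀ g : ℂ → ℝ≥0∞, Measurable g → ∫⁻ ζ, g ζ = ∫⁻ a : ℝ, ∫⁻ b : ℝ, g ⟨a, b⟩ := by
    intro g hg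
    rw [← Complex.volume_preserving_equiv_real_prod.symm.lintegral_comp hg]
    exact lintegral_prod (fun p : ℝ × ℝ => g (Complex.measurableEquivRealProd.symm p))
      (hg.comp Complex.measurableEquivRealProd.symm.measurable).aemeasurable
  have hG' : ∀ {α : Type} [MeasurableSpace α] {a b c d : α → ℝ}, Measurable a → Measurable b →
      Measurable c → Measurable d → Measurable fun t => G (⟨a t, b t⟩, ⟨c t, d t⟩) :=
    fun ha hb hc hd => hG.comp ((hmk.comp (ha.prodMk hb)).prodMk (hmk.comp (hc.prodMk hd)))
  calc ∫⁻ ζ, G ζ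
      = ∫⁻ a : ℝ, ∫⁻ b : ℝ, ∫⁻ c : ℝ, ∫⁻ d : ℝ, G (⟨a, b⟩, ⟨c, d⟩) := by
        rw [Measure.volume_eq_prod, lintegral_prod _ hG.aemeasurable,
          hone _ hG.lintegral_prod_right']
        refine lintegral_congr fun a => lintegral_congr fun b => ?_
        exact hone (fun w => G (⟨a, b⟩, w)) (by fun_prop)
    _ = ∫⁻ a : ℝ, ∫⁻ b : ℝ, ∫⁻ d : ℝ, ∫⁻ c : ℝ, G (⟨a, b⟩, ⟨c, d⟩) := by
        refine lintegral_congr fun a => lintegral_congr fun b => lintegral_lintegral_swap ?_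
        exact (hG' (by fun_prop) (by fun_prop) (by fun_prop) (by fun_prop)).aemeasurable
    _ = ∫⁻ b : ℝ, ∫⁻ a : ℝ, ∫⁻ d : ℝ, ∫⁻ c : ℝ, G (⟨a, b⟩, ⟨c, d⟩) := by
        refine lintegral_lintegral_swap (Measurable.aemeasurable ?_)
        refine Measurable.lintegral_prod_right (Measurable.lintegral_prod_right ?_)
        exact hG' (by fun_prop) (by fun_prop) (by fun_prop) (by fun_prop)
    _ = ∫⁻ b : ℝ, ∫⁻ d : ℝ, ∫⁻ a : ℝ, ∫⁻ c : ℝ, G (⟨a, b⟩, ⟨c, d⟩) := by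
        refine lintegral_congr fun b => lintegral_lintegral_swap (Measurable.aemeasurable ?_)
        refine Measurable.lintegral_prod_right ?_
        exact hG' (by fun_prop) (by fun_prop) (by fun_prop) (by fun_prop)
    _ = ∫⁻ v : ℝ × ℝ, ∫⁻ x : ℝ × ℝ, G (⟨x.1, v.1⟩, ⟨x.2, v.2⟩) := by
        rw [Measure.volume_eq_prod, lintegral_prod]
        · refine lintegral_congr fun b => lintegral_congr fun d => (lintegral_prod
            (fun x : ℝ × ℝ => G (⟨x.1, b⟩, ⟨x.2, d⟩)) ?_).symm
          exact (hG' (by fun_prop) (by fun_prop) (by fun_prop) (by fun_prop)).aemeasurable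
        · refine (Measurable.lintegral_prod_right ?_).aemeasurable
          exact hG' (by fun_prop) (by fun_prop) (by fun_prop) (by fun_prop)

/-! ### The density `|f|²` and its mass on strips. -/

/-- The function on `ℂ × ℂ` that agrees with `f` on `domain`. -/
def extend (f : ℍ × ℍ → ℂ) (w : ℂ × ℂ) : ℂ :=
  f (UpperHalfPlane.ofComplex w.1, UpperHalfPlane.ofComplex w.2)

theorem extend_coe (f : ℍ × ℍ → ℂ) (z : ℍ × ℍ) : extend f (z.1, z.2) = f z := by
  simp [extend]

theorem isOpen_domain : IsOpen domain :=
  (isOpen_lt continuous_const (Complex.continuous_im.comp continuous_fst)).inter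
    (isOpen_lt continuous_const (Complex.continuous_im.comp continuous_snd))

/-- The squared modulus of `f`, extended by zero to `ℂ × ℂ`. -/
def sqDensity (f : ℍ × ℍ → ℂ) : ℂ × ℂ → ℝ≥0∞ :=
  domain.indicator fun w => ‖extend f w‖ₑ ^ 2

theorem IsAnalytic.measurable_sqDensity {f : ℍ × ℍ → ℂ} (hf : IsAnalytic f) :
    Measurable (sqDensity f) := by
  classical
  have hc : ContinuousOn (fun w => ‖extend f w‖ₑ ^ 2) domain :=
    (ENNReal.continuous_pow 2).comp_continuousOn (continuous_enorm.comp_continuousOn hf.continuousOn)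
  unfold sqDensity
  rw [← piecewise_eq_indicator]
  exact hc.measurable_piecewise continuousOn_const isOpen_domain.measurableSet

theorem eLpNorm_two_sq (g : ℝ × ℝ → ℂ) : eLpNorm g 2 volume ^ 2 = ∫⁻ x, ‖g x‖ₑ ^ 2 := by
  have h := eLpNorm_nnreal_pow_eq_lintegral (f := g) (μ := (volume : Measure (ℝ × ℝ)))
    (p := 2) (by norm_num)
  simpa using h

theorem lintegral_enorm_sq_slice_le (f : ℍ × ℍ → ℂ) (y : {t : ℝ // 0 < t} × {t : ℝ // 0 < t}) :
    ∫⁻ x, ‖f (tubePoint x y)‖ₑ ^ 2 ≤ hardyNorm f ^ 2 := by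
  rw [← eLpNorm_two_sq fun x => f (tubePoint x y)]
  gcongr
  exact le_iSup (fun y => eLpNorm (fun x : ℝ × ℝ => f (tubePoint x y)) 2 volume) y

theorem sqDensity_coe (f : ℍ × ℍ → ℂ) (z : ℍ × ℍ) : sqDensity f (z.1, z.2) = ‖f z‖ₑ ^ 2 := by
  rw [sqDensity, indicator_of_mem (show _ ∈ domain from ⟨z.1.im_pos, z.2.im_pos⟩), extend_coe]

/-- The points of `ℂ × ℂ` whose imaginary parts lie in given intervals of length `R`. -/
def strip (a : ℝ × ℝ) (R : ℝ) : Set (ℂ × ℂ) :=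
  {ζ | (ζ.1.im ∈ Icc a.1 (a.1 + R)) ∧ ζ.2.im ∈ Icc a.2 (a.2 + R)}

theorem measurableSet_strip (a : ℝ × ℝ) (R : ℝ) : MeasurableSet (strip a R) :=
  ((Complex.measurable_im.comp measurable_fst) measurableSet_Icc).inter
    ((Complex.measurable_im.comp measurable_snd) measurableSet_Icc)

/-- Each slice of constant imaginary parts carries mass at most `‖f‖²`, and the imaginary parts
range over a square of side `R`; positivity of `a` keeps every slice in `ℍ²`. -/
theorem setLIntegral_strip_sqDensity_le {f : ℍ × ℍ → ℂ} (hf : IsAnalytic f) {a : ℝ × ℝ}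
    (ha₁ : 0 < a.1) (ha₂ : 0 < a.2) (R : ℝ) :
    ∫⁻ ζ in strip a R, sqDensity f ζ ≤ ENNReal.ofReal R ^ 2 * hardyNorm f ^ 2 := by
  rw [← lintegral_indicator (measurableSet_strip a R),
    lintegral_complex_prod (hf.measurable_sqDensity.indicator (measurableSet_strip a R))]
  have hle : ∀ v : ℝ × ℝ, (∫⁻ x : ℝ × ℝ,
      (strip a R).indicator (sqDensity f) (⟨x.1, v.1⟩, ⟨x.2, v.2⟩)) ≤
      (Icc a.1 (a.1 + R) ×ˢ Icc a.2 (a.2 + R)).indicator (fun _ => hardyNorm f ^ 2) v := by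
    intro v
    by_cases hv : v ∈ Icc a.1 (a.1 + R) ×ˢ Icc a.2 (a.2 + R)
    · rw [indicator_of_mem hv]
      refine le_trans (lintegral_mono fun x => ?_) (lintegral_enorm_sq_slice_le f
        (⟨v.1, ha₁.trans_le hv.1.1⟩, ⟨v.2, ha₂.trans_le hv.2.1⟩))
      refine (indicator_le_self _ _ _).trans (le_of_eq ?_)
      exact sqDensity_coe f (tubePoint x
        (⟨v.1, ha₁.trans_le hv.1.1⟩, ⟨v.2, ha₂.trans_le hv.2.1⟩))
    · rw [indicator_of_notMem hv]
      refine le_of_eq ((lintegral_congr fun x => ?_).trans lintegral_zero)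
      exact indicator_of_notMem (s := strip a R) (fun h => hv h) _
  refine (lintegral_mono hle).trans (le_of_eq ?_)
  rw [lintegral_indicator_const (measurableSet_Icc.prod measurableSet_Icc),
    Measure.volume_eq_prod, Measure.prod_prod, Real.volume_Icc, Real.volume_Icc,
    add_sub_cancel_left, add_sub_cancel_left]
  ring

/-! ### Pointwise bound and uniform slice estimate. -/

/-- A pointwise bound of an analytic function by its mean square over a box. -/
theorem IsAnalytic.enorm_sq_mul_le {f : ℍ × ℍ → ℂ} (hf : IsAnalytic f) {w : ℍ × ℍ} {r : ℝ}
    (hr : 0 < r) (h₁ : r ≤ w.1.im) (h₂ : r ≤ w.2.im) :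
    ‖f w‖ₑ ^ 2 * (ENNReal.ofReal r ^ 2 * NNReal.pi) ^ 2 ≤
      ∫⁻ ζ in ball (w.1 : ℂ) r ×ˢ ball (w.2 : ℂ) r, sqDensity f ζ := by
  have him : ∀ {c : ℍ} {ζ : ℂ}, r ≤ c.im → ζ ∈ ball (c : ℂ) r → 0 < ζ.im := by
    intro c ζ hc hζ
    have h := (Complex.abs_im_le_norm (ζ - c)).trans_lt (mem_ball_iff_norm.1 hζ)
    rw [Complex.sub_im, abs_lt] at h
    have : (c : ℂ).im = c.im := rfl
    linarith [h.1]
  have hsub : ball (w.1 : ℂ) r ×ˢ ball (w.2 : ℂ) r ⊆ domain := fun ζ hζ =>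
    ⟨him h₁ hζ.1, him h₂ hζ.2⟩
  -- The inequality is applied to the holomorphic function `f²`, which gives the bound for `|f|²`
  -- without Cauchy–Schwarz.
  have h := enorm_mul_volume_bidisc_le (h := fun ζ => extend f ζ ^ 2) (c := (↑w.1, ↑w.2))
    hf.measurable_sqDensity hr ((DifferentiableOn.mono hf hsub).pow 2) fun ζ hζ => by
      rw [sqDensity, indicator_of_mem (hsub hζ), enorm_pow]
  simp only [Complex.volume_ball, extend_coe, enorm_pow] at h
  rwa [← sq] at h

/-- If `φ` differs from `(p₁ z₁, p₂ z₂)` by a bounded amount and raises the imaginary parts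
`p₁ Im z₁`, `p₂ Im z₂` by at least `r`, then `f ∘ φ` is square integrable on horizontal slices,
with a uniform bound. -/
theorem lintegral_enorm_sq_comp_slice_mul_le {f : ℍ × ℍ → ℂ} (hf : IsAnalytic f)
    {p₁ p₂ r R : ℝ} (hp₁ : 0 < p₁) (hp₂ : 0 < p₂) (hr : 0 < r) {φ : ℍ × ℍ → ℍ × ℍ}
    (hlow₁ : ∀ z, p₁ * z.1.im + r ≤ (φ z).1.im) (hlow₂ : ∀ z, p₂ * z.2.im + r ≤ (φ z).2.im)
    (hdist₁ : ∀ z, ‖((φ z).1 : ℂ) - p₁ * (z.1 : ℂ)‖ + r ≤ R)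
    (hdist₂ : ∀ z, ‖((φ z).2 : ℂ) - p₂ * (z.2 : ℂ)‖ + r ≤ R)
    (y : {t : ℝ // 0 < t} × {t : ℝ // 0 < t}) :
    (∫⁻ x, ‖f (φ (tubePoint x y))‖ₑ ^ 2) * (ENNReal.ofReal r ^ 2 * NNReal.pi) ^ 2 ≤
      ENNReal.ofReal (2 * R / p₁) * ENNReal.ofReal (2 * R / p₂) *
        (ENNReal.ofReal R ^ 2 * hardyNorm f ^ 2) := by
  set a : ℝ × ℝ := (p₁ * y.1, p₂ * y.2) with ha
  have ha₁ : 0 < a.1 := mul_pos hp₁ y.1.2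
  have ha₂ : 0 < a.2 := mul_pos hp₂ y.2.2
  -- A closed relation containing every pair of an `x` and a `ζ` in the bidisc about `φ(x + iy)`. It
  -- does not mention `φ`, so Tonelli applies although `φ` is not assumed measurable here.
  let E : Set ((ℝ × ℝ) × (ℂ × ℂ)) :=
    {q | |q.2.1.re - p₁ * q.1.1| ≤ R ∧ |q.2.2.re - p₂ * q.1.2| ≤ R}
  have hE : MeasurableSet E := by
    have h₁ : Continuous fun q : (ℝ × ℝ) × (ℂ × ℂ) => |q.2.1.re - p₁ * q.1.1| := by fun_prop
    have h₂ : Continuous fun q : (ℝ × ℝ) × (ℂ × ℂ) => |q.2.2.re - p₂ * q.1.2| := by fun_prop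
    exact ((isClosed_le h₁ continuous_const).inter
      (isClosed_le h₂ continuous_const)).measurableSet
  have hbox : ∀ {p t s : ℝ} {c z : ℍ} {ζ : ℂ}, z.re = t → z.im = s → p * z.im + r ≤ c.im →
      ‖(c : ℂ) - p * (z : ℂ)‖ + r ≤ R → ζ ∈ ball (c : ℂ) r →
      |ζ.re - p * t| ≤ R ∧ ζ.im ∈ Icc (p * s) (p * s + R) := by
    rintro p t s c z ζ rfl rfl hlow hdist hζ
    have hζ' := mem_ball_iff_norm.1 hζ
    have hn : ‖ζ - p * (z : ℂ)‖ ≤ R := by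
      calc ‖ζ - p * (z : ℂ)‖ = ‖(ζ - c) + (c - p * (z : ℂ))‖ := by ring_nf
        _ ≤ ‖ζ - c‖ + ‖(c : ℂ) - p * (z : ℂ)‖ := norm_add_le _ _
        _ ≤ R := by linarith
    have hre := (Complex.abs_re_le_norm _).trans hn
    have him := (Complex.abs_im_le_norm _).trans hn
    have hlo := (Complex.abs_im_le_norm _).trans_lt hζ'
    have e1 : (ζ - p * (z : ℂ)).re = ζ.re - p * z.re := by simp
    have e2 : (ζ - p * (z : ℂ)).im = ζ.im - p * z.im := by simp
    have e3 : (ζ - (c : ℂ)).im = ζ.im - c.im := by simp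
    rw [e1] at hre
    rw [e2, abs_le] at him
    rw [e3, abs_lt] at hlo
    -- The lower bound on `Im ζ` comes from the gain `r` in `hlow` cancelling the radius; the upper
    -- one from `hdist`.
    exact ⟨hre, by linarith, by linarith⟩
  have hpt : ∀ x : ℝ × ℝ, ‖f (φ (tubePoint x y))‖ₑ ^ 2 * (ENNReal.ofReal r ^ 2 * NNReal.pi) ^ 2 ≤
      ∫⁻ ζ in strip a R, E.indicator 1 (x, ζ) * sqDensity f ζ := by
    intro x
    have hpos₁ : 0 < p₁ * (tubePoint x y).1.im := mul_pos hp₁ (tubePoint x y).1.im_pos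
    have hpos₂ : 0 < p₂ * (tubePoint x y).2.im := mul_pos hp₂ (tubePoint x y).2.im_pos
    refine (hf.enorm_sq_mul_le hr (by linarith [hlow₁ (tubePoint x y)])
      (by linarith [hlow₂ (tubePoint x y)])).trans ?_
    have hmem : ∀ ζ ∈ ball ((φ (tubePoint x y)).1 : ℂ) r ×ˢ ball ((φ (tubePoint x y)).2 : ℂ) r,
        (x, ζ) ∈ E ∧ ζ ∈ strip a R := by
      intro ζ hζ
      have h₁ := hbox (t := x.1) (s := y.1) rfl rfl (hlow₁ _) (hdist₁ _) hζ.1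
      have h₂ := hbox (t := x.2) (s := y.2) rfl rfl (hlow₂ _) (hdist₂ _) hζ.2
      exact ⟨⟨h₁.1, h₂.1⟩, h₁.2, h₂.2⟩
    calc _ = ∫⁻ ζ in ball ((φ (tubePoint x y)).1 : ℂ) r ×ˢ ball ((φ (tubePoint x y)).2 : ℂ) r,
          E.indicator 1 (x, ζ) * sqDensity f ζ := by
          refine setLIntegral_congr_fun (measurableSet_ball.prod measurableSet_ball) fun ζ hζ => ?_
          simp [indicator_of_mem (hmem ζ hζ).1]
      _ ≤ _ := lintegral_mono_set fun ζ hζ => (hmem ζ hζ).2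
  have hvol : ∀ ζ : ℂ × ℂ, ∫⁻ x : ℝ × ℝ, E.indicator 1 (x, ζ) =
      ENNReal.ofReal (2 * R / p₁) * ENNReal.ofReal (2 * R / p₂) := by
    intro ζ
    have hIcc : ∀ {p t s : ℝ}, 0 < p → (|t - p * s| ≤ R ↔ s ∈ Icc ((t - R) / p) ((t + R) / p)) := by
      intro p t s hp
      rw [mem_Icc, div_le_iff₀ hp, le_div_iff₀ hp, abs_le]
      constructor <;> rintro ⟨h, h'⟩ <;> constructor <;> linarith
    have hset : (fun x : ℝ × ℝ => E.indicator (1 : (ℝ × ℝ) × (ℂ × ℂ) → ℝ≥0∞) (x, ζ)) =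
        (Icc ((ζ.1.re - R) / p₁) ((ζ.1.re + R) / p₁) ×ˢ
          Icc ((ζ.2.re - R) / p₂) ((ζ.2.re + R) / p₂)).indicator 1 := by
      funext x
      refine indicator_eq_indicator ?_ rfl
      exact and_congr (hIcc hp₁) (hIcc hp₂)
    rw [hset, lintegral_indicator_one (measurableSet_Icc.prod measurableSet_Icc),
      Measure.volume_eq_prod, Measure.prod_prod, Real.volume_Icc, Real.volume_Icc]
    congr 2 <;> ring
  have hEm : Measurable (E.indicator (1 : (ℝ × ℝ) × (ℂ × ℂ) → ℝ≥0∞)) := measurable_one.indicator hE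
  have hsq := hf.measurable_sqDensity
  have htop : (ENNReal.ofReal r ^ 2 * (NNReal.pi : ℝ≥0∞)) ^ 2 ≠ ∞ := by finiteness
  rw [← lintegral_mul_const' _ _ htop]
  calc _ ≤ ∫⁻ x, ∫⁻ ζ in strip a R, E.indicator 1 (x, ζ) * sqDensity f ζ := lintegral_mono hpt
    _ = ∫⁻ ζ in strip a R, ∫⁻ x, E.indicator 1 (x, ζ) * sqDensity f ζ := by
        refine lintegral_lintegral_swap (Measurable.aemeasurable ?_)
        exact hEm.mul (hsq.comp measurable_snd)
    _ = ∫⁻ ζ in strip a R,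
          ENNReal.ofReal (2 * R / p₁) * ENNReal.ofReal (2 * R / p₂) * sqDensity f ζ := by
        refine lintegral_congr fun ζ => ?_
        rw [lintegral_mul_const _ (by fun_prop), hvol]
    _ = ENNReal.ofReal (2 * R / p₁) * ENNReal.ofReal (2 * R / p₂) *
          ∫⁻ ζ in strip a R, sqDensity f ζ := lintegral_const_mul _ hsq
    _ ≤ _ := by
        gcongr
        exact setLIntegral_strip_sqDensity_le hf ha₁ ha₂ R

/-! ### Analyticity of compositions and the bounded operator. -/

/-- The composition of an analytic function with an analytic self-map is analytic. -/
theorem IsAnalytic.comp {f : ℍ × ℍ → ℂ} (hf : IsAnalytic f) {φ : ℍ × ℍ → ℍ × ℍ}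
    (h₁ : IsAnalytic fun z => ((φ z).1 : ℂ)) (h₂ : IsAnalytic fun z => ((φ z).2 : ℂ)) :
    IsAnalytic (f ∘ φ) := by
  have h := DifferentiableOn.comp (g := extend f) hf (h₁.prodMk h₂)
    fun w _ => ⟨UpperHalfPlane.im_pos _, UpperHalfPlane.im_pos _⟩
  refine h.congr fun w _ => ?_
  exact (extend_coe f _).symm

theorem isAnalytic_fst_affine {p : ℝ} {ψ : ℍ × ℍ → ℂ} (hψ : IsAnalytic ψ) :
    IsAnalytic fun z => p * (z.1 : ℂ) + ψ z := by
  refine DifferentiableOn.add ?_ hψ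
  refine DifferentiableOn.congr (f := fun w : ℂ × ℂ => (p : ℂ) * w.1) (by fun_prop) fun w hw => ?_
  simp [UpperHalfPlane.ofComplex_apply_of_im_pos hw.1]

theorem isAnalytic_snd_affine {p : ℝ} {ψ : ℍ × ℍ → ℂ} (hψ : IsAnalytic ψ) :
    IsAnalytic fun z => p * (z.2 : ℂ) + ψ z := by
  refine DifferentiableOn.add ?_ hψ
  refine DifferentiableOn.congr (f := fun w : ℂ × ℂ => (p : ℂ) * w.2) (by fun_prop) fun w hw => ?_
  simp [UpperHalfPlane.ofComplex_apply_of_im_pos hw.2]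

/-- A composition operator that does not increase the Hardy norm by more than a constant factor,
as a bounded operator on the Hardy space. -/
def compOperator (φ : ℍ × ℍ → ℍ × ℍ) (hφ : ∀ f, IsAnalytic f → IsAnalytic (f ∘ φ)) (K : ℝ≥0∞)
    (hK : K ≠ ∞) (h : ∀ f, IsAnalytic f → hardyNorm (f ∘ φ) ≤ K * hardyNorm f) :
    HardySpace →L[ℂ] HardySpace :=
  LinearMap.mkContinuous
    { toFun := fun f => ⟨f.1 ∘ φ, hφ _ f.2.1,
        (h _ f.2.1).trans_lt (ENNReal.mul_lt_top hK.lt_top f.2.2)⟩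
      map_add' := fun _ _ => rfl
      map_smul' := fun _ _ => rfl } K.toReal fun f => by
    change (hardyNorm (f.1 ∘ φ)).toReal ≤ K.toReal * (hardyNorm f.1).toReal
    rw [← ENNReal.toReal_mul]
    exact ENNReal.toReal_mono (ENNReal.mul_ne_top hK f.2.2.ne) (h _ f.2.1)

end BiHalfPlane

end

theorem proposition6 (p₁ p₂ δ : ℝ) (hp₁ : 0 < p₁) (hp₂ : 0 < p₂) (hδ : 0 < δ)
    (ψ₁ ψ₂ : ℍ × ℍ → ℂ)
    (hψ₁ : BiHalfPlane.MemHInfty ψ₁) (hψ₂ : BiHalfPlane.MemHInfty ψ₂)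
    (him₁ : ∀ z, δ < (ψ₁ z).im) (him₂ : ∀ z, δ < (ψ₂ z).im)
    (φ : ℍ × ℍ → ℍ × ℍ)
    (hφ : ∀ z : ℍ × ℍ, ((φ z).1 : ℂ) = p₁ * (z.1 : ℂ) + ψ₁ z ∧
      ((φ z).2 : ℂ) = p₂ * (z.2 : ℂ) + ψ₂ z) :
    ∃ C : BiHalfPlane.HardySpace →L[ℂ] BiHalfPlane.HardySpace,
      ∀ (f : BiHalfPlane.HardySpace) (z : ℍ × ℍ), C f z = f (φ z) := by
  obtain ⟨hψ₁, M₁, hM₁⟩ := hψ₁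
  obtain ⟨hψ₂, M₂, hM₂⟩ := hψ₂
  have hd₁ : ∀ z, ((φ z).1 : ℂ) - p₁ * (z.1 : ℂ) = ψ₁ z := fun z => by rw [(hφ z).1]; ring
  have hd₂ : ∀ z, ((φ z).2 : ℂ) - p₂ * (z.2 : ℂ) = ψ₂ z := fun z => by rw [(hφ z).2]; ring
  have hlow₁ : ∀ z, p₁ * z.1.im + δ ≤ (φ z).1.im := fun z => by
    have h := congrArg Complex.im (hφ z).1
    simp only [UpperHalfPlane.coe_im, Complex.add_im, Complex.im_ofReal_mul] at h
    linarith [him₁ z]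
  have hlow₂ : ∀ z, p₂ * z.2.im + δ ≤ (φ z).2.im := fun z => by
    have h := congrArg Complex.im (hφ z).2
    simp only [UpperHalfPlane.coe_im, Complex.add_im, Complex.im_ofReal_mul] at h
    linarith [him₂ z]
  have han : ∀ f, BiHalfPlane.IsAnalytic f → BiHalfPlane.IsAnalytic (f ∘ φ) := fun f hf => by
    refine hf.comp ?_ ?_
    · simpa only [hφ] using BiHalfPlane.isAnalytic_fst_affine hψ₁
    · simpa only [hφ] using BiHalfPlane.isAnalytic_snd_affine hψ₂
  -- `R` is the bound on the `ψ_j` plus the bidisc radius `δ`, and `V` is the volume of the bidisc.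
  -- The slice estimate bounds squared norms by the factor `D / V`, whence the square root below.
  set R : ℝ := max M₁ M₂ + δ
  set V : ℝ≥0∞ := (ENNReal.ofReal δ ^ 2 * NNReal.pi) ^ 2 with hV
  set D : ℝ≥0∞ := ENNReal.ofReal (2 * R / p₁) * ENNReal.ofReal (2 * R / p₂) *
    ENNReal.ofReal R ^ 2 with hD
  have hV0 : V ≠ 0 := by simp [hV, hδ, NNReal.pi_ne_zero]
  have hVt : V ≠ ∞ := by finiteness
  have hDV : D / V ≠ ∞ := ENNReal.div_ne_top (by finiteness) hV0
  refine ⟨BiHalfPlane.compOperator φ han ((D / V) ^ (2⁻¹ : ℝ)) (by finiteness)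
    fun f hf => iSup_le fun y => ?_, fun f z => rfl⟩
  have h := BiHalfPlane.lintegral_enorm_sq_comp_slice_mul_le hf hp₁ hp₂ hδ hlow₁ hlow₂
    (R := R) (fun z => by rw [hd₁]; exact add_le_add_left ((hM₁ z).trans (le_max_left _ _)) _)
    (fun z => by rw [hd₂]; exact add_le_add_left ((hM₂ z).trans (le_max_right _ _)) _) y
  rw [← BiHalfPlane.eLpNorm_two_sq fun x => f (φ (BiHalfPlane.tubePoint x y)), ← mul_assoc,
    ← ENNReal.le_div_iff_mul_le (Or.inl hV0) (Or.inl hVt), ENNReal.mul_div_right_comm] at h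
  have hs : ((D / V) ^ (2⁻¹ : ℝ) * BiHalfPlane.hardyNorm f) ^ 2 =
      D / V * BiHalfPlane.hardyNorm f ^ 2 := by
    rw [mul_pow, ← ENNReal.rpow_natCast, ← ENNReal.rpow_mul]
    norm_num
  rw [← hs] at h
  exact (ENNReal.pow_le_pow_left_iff two_ne_zero).1 h
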